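/- **Conventions.** Words are over finite alphabets $\Sigma$. An LTL formula over $\Sigma$ is built from $\top,\bot,Q_a$ ($a\in\Sigma$) by $\wedge,\vee,\neg$ and the strict temporal operators $\mathsf S$ (since) and $\mathsf U$ (until): for $w=a_1\cdots a_n$, $w,i\models Q_a$ iff $a_i=a$; $w,i\models\varphi\,\mathsf S\,\psi$ iff there is $j<i$ with $w,j\models\psi$ and $w,l\models\varphi$ for all $j<l<i$; $w,i\models\varphi\,\mathsf U\,\psi$ iff there is $j>i$, $j\le n$, with $w,j\models\psi$ and $w,l\models\varphi$ for all $i<l<j$. It is given with an output position (first or last) and recognizes the set of nonempty words $w$ that satisfy it at that position. A masked unique hard-attention transformer (UHAT) over $\Sigma$ consists of a token embedding $\Sigma\to\mathbb Q^d$ ($d>0$), a finite sequence of layers of matching widths, an acceptance vector $t\in\mathbb Q^s$, where $s$ is the final width, and an output position (first or last). A ReLU layer replaces one fixed coordinate $x$ of every vector by $\max\{0,x\}$. An attention layer of width $r>0$ is given by affine maps $A,B:\mathbb Q^r\to\mathbb Q^r$ and $C:\mathbb Q^{2r}\to\mathbb Q^{s'}$ with rational coefficients, a mask (no mask, $j<i$,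 or $j>i$) and a tie-breaking rule (leftmost or rightmost); it maps $v_1,\dots,v_n$ to $C(v_1,a_1),\dots,C(v_n,a_n)$, where $a_i=v_j$ for the leftmost (resp. rightmost) unmasked position $j$ that maximizes $\langle A(v_i),B(v_j)\rangle$ among the unmasked positions, and $a_i=0$ if there is no unmasked position. The UHAT accepts a nonempty word iff $\langle t,v\rangle>0$ for the final vector $v$ at the output position. The size $|R|$ of a UHAT or an LTL formula $R$ is the length of its usual binary encoding (all matrix and vector entries are listed, with numbers in binary; formulas are written as strings). **Theorem.** UHATs can be exponentially more succinct than LTL. That is, for every function $f\in 2^{o(n)}$ there is a UHAT $\mathcal T$ such that every LTL formula $\varphi$ over the same alphabet that recognizes the same language as $\mathcal T$ has size $|\varphi|>f(|\mathcal T|)$. Moreover: 1. there are a polynomial $p$ and a family $(\mathcal T_n)_{n\ge 0}$ of UHATs with $|\mathcal T_n|\le p(n)$ such that $\mathcal T_n$ accepts some word and every word accepted by $\mathcal T_n$ has length at least $2^{2^n}$; 2. there is a constant $c$ such that every LTL formula $\varphi$ whose language is nonempty accepts some word of length at most $2^{c|\varphi|}$. -/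

import Mathlib

open Filter Asymptotics

/-! ### Output positions -/

/-- Which position of a nonempty word carries the verdict. -/
inductive OutPos : Type
  | first
  | last

/-- The output position as an index into a nonempty sequence. -/
def OutPos.idx : OutPos → {n : ℕ} → 0 < n → Fin n
  | .first, _, h => ⟨0, h⟩
  | .last, n, h => ⟨n - 1, Nat.sub_lt h Nat.one_pos⟩

/-! ### Linear temporal logic on finite words -/

/-- LTL formulas with (strict) since and until over the alphabet `Fin k`. -/
inductive LTL (k : ℕ) : Type
  | tru : LTL k
  | fls : LTL k
  | sym (a : Fin k) : LTL k
  | and (φ ψ : LTL k) : LTL k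
  | or (φ ψ : LTL k) : LTL k
  | not (φ : LTL k) : LTL k
  | since (φ ψ : LTL k) : LTL k
  | until (φ ψ : LTL k) : LTL k

/-- `φ.Sat w i` is satisfaction `w, i ⊨ φ`; positions are numbered from `0`. -/
def LTL.Sat {k : ℕ} (w : List (Fin k)) : LTL k → Fin w.length → Prop
  | .tru, _ => True
  | .fls, _ => False
  | .sym a, i => w.get i = a
  | .and φ ψ, i => φ.Sat w i ∧ ψ.Sat w i
  | .or φ ψ, i => φ.Sat w i ∨ ψ.Sat w i
  | .not φ, i => ¬ φ.Sat w i
  | .since φ ψ, i => ∃ j, j < i ∧ ψ.Sat w j ∧ ∀ l, j < l → l < i → φ.Sat w l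
  | .until φ ψ, i => ∃ j, i < j ∧ ψ.Sat w j ∧ ∀ l, i < l → l < j → φ.Sat w l

/-- An LTL formula used as a language recognizer: a formula together with its output position. -/
structure LTLRecognizer (k : ℕ) where
  formula : LTL k
  out : OutPos

/-- The recognized language. The empty word has no output position and is never accepted. -/
def LTLRecognizer.language {k : ℕ} (R : LTLRecognizer k) : Language (Fin k) :=
  {w | ∃ h : 0 < w.length, R.formula.Sat w (R.out.idx h)}

/-! ### Masked unique hard-attention transformers -/

/-- An affine transformation `x ↦ Q x + b` from `ℚ^m` to `ℚ^n` with rational coefficients. -/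
structure RatAffine (m n : ℕ) where
  mat : Matrix (Fin n) (Fin m) ℚ
  vec : Fin n → ℚ

/-- Application of an affine transformation. -/
def RatAffine.app {m n : ℕ} (T : RatAffine m n) (x : Fin m → ℚ) : Fin n → ℚ :=
  T.mat.mulVec x + T.vec

/-- Mask predicates: no masking, strict future masking, strict past masking. -/
inductive Mask : Type
  | none
  | future
  | past

/-- The set `U_i` of unmasked positions: all `j`, the `j < i`, or the `j > i`. -/
def Mask.unmasked {n : ℕ} : Mask → Fin n → Finset (Fin n)
  | .none, _ => Finset.univ
  | .future, i => Finset.univ.filter (fun j => j < i)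
  | .past, i => Finset.univ.filter (fun j => i < j)

/-- Tie-breaking: leftmost (`min`) or rightmost (`max`). -/
inductive TieBreak : Type
  | leftmost
  | rightmost

/-- The element of a finite nonempty set of positions that the tie-breaking function selects. -/
def TieBreak.select {n : ℕ} : TieBreak → (s : Finset (Fin n)) → s.Nonempty → Fin n
  | .leftmost, s, h => s.min' h
  | .rightmost, s, h => s.max' h

/-- The elements of `U` that maximize the score `S`. -/
def maximizers {n : ℕ} (U : Finset (Fin n)) (S : Fin n → ℚ) : Finset (Fin n) :=
  U.filter (fun j => ∀ j' ∈ U, S j' ≤ S j)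

theorem maximizers_nonempty {n : ℕ} {U : Finset (Fin n)} (S : Fin n → ℚ) (h : U.Nonempty) :
    (maximizers U S).Nonempty := by
  obtain ⟨j, hj, hmax⟩ := U.exists_max_image S h
  exact ⟨j, Finset.mem_filter.mpr ⟨hj, hmax⟩⟩

/-- The attention vector at position `i`: the vector at the selected unmasked position of
maximal score `⟨A v_i, B v_j⟩`, or `0` if every position is masked. -/
def attentionVector {r n : ℕ} (A B : RatAffine r r) (M : Mask) (τ : TieBreak)
    (v : Fin n → Fin r → ℚ) (i : Fin n) : Fin r → ℚ :=
  if h : (M.unmasked i).Nonempty then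
    v (τ.select (maximizers (M.unmasked i) (fun j => dotProduct (A.app (v i)) (B.app (v j))))
      (maximizers_nonempty _ h))
  else 0

/-- Finite sequences of layers of matching widths, from width `d` to width `e`. -/
inductive Layers : ℕ → ℕ → Type
  /-- No further layer. -/
  | nil {d : ℕ} : Layers d d
  /-- A masked unique hard-attention layer of width `r` with output width `s`, followed by `L`. -/
  | attention {r s e : ℕ} (hr : 0 < r) (A B : RatAffine r r) (C : RatAffine (r + r) s)
      (M : Mask) (τ : TieBreak) (L : Layers s e) : Layers r e
  /-- A ReLU layer of width `r` acting on coordinate `c`, followed by `L`. -/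
  | relu {r e : ℕ} (c : Fin r) (L : Layers r e) : Layers r e

/-- The length-preserving function on sequences of vectors computed by a sequence of layers. -/
def Layers.run {n : ℕ} : {d e : ℕ} → Layers d e → (Fin n → Fin d → ℚ) → (Fin n → Fin e → ℚ)
  | _, _, .nil, v => v
  | _, _, .attention _ A B C M τ L, v =>
      L.run (fun i => C.app (Fin.append (v i) (attentionVector A B M τ v i)))
  | _, _, .relu c L, v => L.run (fun i => Function.update (v i) c (max 0 (v i c)))

/-- A masked unique hard-attention transformer over the alphabet `Fin k`, given with
its acceptance vector and output position. -/
structure UHAT (k : ℕ) where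
  dim : ℕ
  dim_pos : 0 < dim
  /-- the token embedding -/
  emb : Fin k → Fin dim → ℚ
  outDim : ℕ
  layers : Layers dim outDim
  /-- the acceptance vector -/
  acc : Fin outDim → ℚ
  out : OutPos

/-- The output sequence of the transformer on a word. -/
def UHAT.output {k : ℕ} (T : UHAT k) (w : List (Fin k)) : Fin w.length → Fin T.outDim → ℚ :=
  T.layers.run (fun i => T.emb (w.get i))

/-- The recognized language. The empty word has no output position and is never accepted. -/
def UHAT.language {k : ℕ} (T : UHAT k) : Language (Fin k) :=
  {w | ∃ h : 0 < w.length, 0 < dotProduct T.acc (T.output w (T.out.idx h))}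

/-! ### Binary encodings and sizes

Natural numbers are written in binary in a self-delimiting way, rationals as reduced fractions,
vectors and matrices by listing all their entries, formulas in prefix notation. -/

/-- Self-delimiting binary encoding: every binary digit is preceded by `true`, and `false` ends
the number. -/
def encNat (n : ℕ) : List Bool := n.bits.flatMap (fun b => [true, b]) ++ [false]

/-- A sign bit and the absolute value. -/
def encInt (z : ℤ) : List Bool := decide (z < 0) :: encNat z.natAbs

/-- Numerator and denominator of the reduced fraction. -/
def encRat (q : ℚ) : List Bool := encInt q.num ++ encNat q.den

def encVec {n : ℕ} (v : Fin n → ℚ) : List Bool := (List.ofFn v).flatMap encRat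

/-- Row by row. -/
def encMat {m n : ℕ} (Q : Matrix (Fin m) (Fin n) ℚ) : List Bool :=
  (List.ofFn (fun i => encVec (Q i))).flatten

def RatAffine.encode {m n : ℕ} (T : RatAffine m n) : List Bool := encMat T.mat ++ encVec T.vec

def OutPos.encode : OutPos → List Bool
  | .first => [false]
  | .last => [true]

def Mask.encode : Mask → List Bool
  | .none => [false, false]
  | .future => [false, true]
  | .past => [true, false]

def TieBreak.encode : TieBreak → List Bool
  | .leftmost => [false]
  | .rightmost => [true]

def Layers.encode : {d e : ℕ} → Layers d e → List Bool
  | _, _, .nil => [false, false]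
  | _, _, .attention (s := s) _ A B C M τ L =>
      [false, true] ++ encNat s ++ A.encode ++ B.encode ++ C.encode ++ M.encode ++ τ.encode
        ++ L.encode
  | _, _, .relu c L => [true, false] ++ encNat c ++ L.encode

/-- Alphabet size, embedding dimension, embedding vectors, layers, acceptance vector, output
position. -/
def UHAT.encode {k : ℕ} (T : UHAT k) : List Bool :=
  encNat k ++ encNat T.dim ++ (List.ofFn (fun a => encVec (T.emb a))).flatten ++ T.layers.encode
    ++ encVec T.acc ++ T.out.encode

/-- The size of a transformer: the length of its binary encoding. -/
def UHAT.size {k : ℕ} (T : UHAT k) : ℕ := T.encode.length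

/-- Prefix notation with three-bit operator codes and letters in binary. -/
def LTL.encode {k : ℕ} : LTL k → List Bool
  | .tru => [false, false, false]
  | .fls => [false, false, true]
  | .sym a => [false, true, false] ++ encNat a
  | .and φ ψ => [false, true, true] ++ φ.encode ++ ψ.encode
  | .or φ ψ => [true, false, false] ++ φ.encode ++ ψ.encode
  | .not φ => [true, false, true] ++ φ.encode
  | .since φ ψ => [true, true, false] ++ φ.encode ++ ψ.encode
  | .until φ ψ => [true, true, true] ++ φ.encode ++ ψ.encode

/-- The size of an LTL recognizer: the length of its binary encoding. -/
def LTLRecognizer.size {k : ℕ} (R : LTLRecognizer k) : ℕ :=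
  (R.formula.encode ++ R.out.encode).length

/-! ### Succinctness -/

/-- A class of finite representations of languages over the alphabets `Fin k`, with sizes. -/
structure RepClass where
  Rep : ℕ → Type
  language : {k : ℕ} → Rep k → Language (Fin k)
  size : {k : ℕ} → Rep k → ℕ

/-- The class of UHATs. -/
def uhatClass : RepClass := ⟨UHAT, UHAT.language, UHAT.size⟩

/-- The class of LTL formulas. -/
def ltlClass : RepClass := ⟨LTLRecognizer, LTLRecognizer.language, LTLRecognizer.size⟩

/-- `f ∈ 2^{o(n)}`. -/
def InTwoPowLittleO (f : ℕ → ℝ) : Prop :=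
  ∃ g : ℕ → ℝ, g =o[atTop] (fun n : ℕ => (n : ℝ)) ∧ ∀ᶠ n : ℕ in atTop, f n ≤ (2 : ℝ) ^ g n

/-- `C₁` can be exponentially more succinct than `C₂`: for every `f ∈ 2^{o(n)}` there is `R₁` in
`C₁` such that every `R₂` in `C₂` representing the same language has size greater than
`f (size of R₁)`. -/
def CanBeExpMoreSuccinct (C₁ C₂ : RepClass) : Prop :=
  ∀ f : ℕ → ℝ, InTwoPowLittleO f →
    ∃ (k : ℕ) (R₁ : C₁.Rep k), ∀ R₂ : C₂.Rep k,
      C₂.language R₂ = C₁.language R₁ → f (C₁.size R₁) < (C₂.size R₂ : ℝ)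

/-! ### Small models for LTL -/

/-! The two halves meet in one inequality: a language whose shortest word has length at least `2 ^ 2
^ n` forces every LTL formula for it to have size at least `2 ^ n`, while some transformers of size
linear in `n` have such languages.

Small models for LTL. By its one-step unfolding, a strict `since` is determined by truth values at
the previous position and an `until` by those at the next one. Hence two positions where the same
subformulas hold can be glued together and the segment between them removed (`LTL.satAt_cut`). By
pigeonhole a shortest model has at most exponentially many positions
(`LTLRecognizer.exists_short_word`).

Long words for UHATs. A word over four letters logs the bit flips of a binary counter with `2 ^ n`
bits: each event letter sets the bit whose `n`-bit address is read from the preceding positions. A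
log is correct if every event happens at the address dictated by the carry rule and really flips the
stored bit. Reaching the highest address takes at least `2 ^ (2 ^ n - 1)` positions
(`bitValue_memory_le`), and a correct log reaching it exists (`exists_goodLog`).

Checking a log needs, at each event, only the last event and the last event with the same address.
Unique hard attention finds the latter by maximizing `2xy - y²` plus an event bonus, that is, by
minimizing `(x - y)²`. Addresses are assembled bit by bit in `n` identical rounds, scaled into `[0,
1)`; so all coefficients are independent of `n`, the size is affine in `n`, and ReLU can multiply by
a bit. Each position yields a violation that is `0` or at least `2 ^ (-n)`; a final attention layer
collects the largest one (`mem_counterUHAT_language`). -/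

namespace LTL

/-- The list of subformula occurrences. -/
def subs {k : ℕ} : LTL k → List (LTL k)
  | .tru => [.tru]
  | .fls => [.fls]
  | .sym a => [.sym a]
  | .and φ ψ => .and φ ψ :: (φ.subs ++ ψ.subs)
  | .or φ ψ => .or φ ψ :: (φ.subs ++ ψ.subs)
  | .not φ => .not φ :: φ.subs
  | .since φ ψ => .since φ ψ :: (φ.subs ++ ψ.subs)
  | .until φ ψ => .until φ ψ :: (φ.subs ++ ψ.subs)

theorem self_mem_subs {k : ℕ} (φ : LTL k) : φ ∈ φ.subs := by
  cases φ <;> simp [subs]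

theorem length_subs_le {k : ℕ} (φ : LTL k) : φ.subs.length ≤ φ.encode.length := by
  induction φ <;> simp [subs, encode] at * <;> omega

/-- Satisfaction at a natural number, false beyond the end of the word. -/
def SatAt {k : ℕ} (w : List (Fin k)) (φ : LTL k) (p : ℕ) : Prop :=
  ∃ h : p < w.length, φ.Sat w ⟨p, h⟩

/-- No bound on `p` is needed, since both sides fail once `p + 1` lies beyond the end. -/
theorem satAt_until {k : ℕ} (w : List (Fin k)) (φ ψ : LTL k) (p : ℕ) :
    SatAt w (.until φ ψ) p ↔
      SatAt w ψ (p + 1) ∨ (SatAt w φ (p + 1) ∧ SatAt w (.until φ ψ) (p + 1)) := by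
  constructor
  · rintro ⟨h, ⟨j, hj⟩, hpj, hψ, hφ⟩
    have hpj' : p < j := hpj
    rcases Nat.lt_or_ge (p + 1) j with h1 | h1
    · right
      refine ⟨⟨by omega, hφ ⟨p + 1, by omega⟩ (by simp [Fin.lt_def]) (by simpa [Fin.lt_def])⟩,
        by omega, ⟨j, hj⟩, by simpa [Fin.lt_def], hψ, fun l h2 h3 => hφ l ?_ h3⟩
      simp only [Fin.lt_def] at h2 ⊢; omega
    · left
      obtain rfl : j = p + 1 := by omega
      exact ⟨hj, hψ⟩
  · rintro (⟨h, hψ⟩ | ⟨⟨h, hφ⟩, _, j, hpj, hψ, hl⟩)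
    · refine ⟨by omega, ⟨p + 1, h⟩, by simp [Fin.lt_def], hψ, fun l h2 h3 => ?_⟩
      simp only [Fin.lt_def] at h2 h3; omega
    · refine ⟨by omega, j, ?_, hψ, fun l h2 h3 => ?_⟩
      · simp only [Fin.lt_def] at hpj ⊢; omega
      · rcases Nat.lt_or_ge (p + 1) l with h4 | h4
        · exact hl l (by simpa [Fin.lt_def]) h3
        · have : l = ⟨p + 1, h⟩ := by
            simp only [Fin.lt_def] at h2; ext; simp; omega
          rwa [this]

theorem not_satAt_since_zero {k : ℕ} (w : List (Fin k)) (φ ψ : LTL k) :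
    ¬ SatAt w (.since φ ψ) 0 := by
  rintro ⟨h, j, hj, -⟩
  simp [Fin.lt_def] at hj

theorem satAt_since {k : ℕ} (w : List (Fin k)) (φ ψ : LTL k) (p : ℕ) (hp : p + 1 < w.length) :
    SatAt w (.since φ ψ) (p + 1) ↔
      SatAt w ψ p ∨ (SatAt w φ p ∧ SatAt w (.since φ ψ) p) := by
  constructor
  · rintro ⟨h, ⟨j, hj⟩, hpj, hψ, hφ⟩
    have hpj' : j < p + 1 := hpj
    rcases Nat.lt_or_ge j p with h1 | h1
    · right
      refine ⟨⟨by omega, hφ ⟨p, by omega⟩ (by simpa [Fin.lt_def]) (by simp [Fin.lt_def])⟩,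
        by omega, ⟨j, hj⟩, by simpa [Fin.lt_def], hψ, fun l h2 h3 => hφ l h2 ?_⟩
      simp only [Fin.lt_def] at h3 ⊢; omega
    · left
      obtain rfl : j = p := by omega
      exact ⟨hj, hψ⟩
  · rintro (⟨h, hψ⟩ | ⟨⟨h, hφ⟩, _, j, hpj, hψ, hl⟩)
    · refine ⟨by omega, ⟨p, h⟩, by simp [Fin.lt_def], hψ, fun l h2 h3 => ?_⟩
      simp only [Fin.lt_def] at h2 h3; omega
    · refine ⟨by omega, j, ?_, hψ, fun l h2 h3 => ?_⟩
      · simp only [Fin.lt_def] at hpj ⊢; omega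
      · rcases Nat.lt_or_ge l p with h4 | h4
        · exact hl l h2 (by simpa [Fin.lt_def])
        · have : l = ⟨p, h⟩ := by
            simp only [Fin.lt_def] at h3; ext; simp; omega
          rwa [this]

theorem not_satAt_of_le {k : ℕ} {w : List (Fin k)} {p : ℕ} (φ : LTL k) (h : w.length ≤ p) :
    ¬ SatAt w φ p := fun ⟨h', _⟩ => by omega

/-- If two positions `i < j` satisfy the same subformulas, cutting out the positions
`i + 1, …, j` preserves satisfaction at the remaining ones. -/
theorem satAt_cut {k : ℕ} (w w' : List (Fin k)) (i d : ℕ) (hlen : w'.length + d = w.length)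
    (hi : i < w'.length)
    (hle : ∀ p ≤ i, w'[p]? = w[p]?) (hgt : ∀ p, i < p → w'[p]? = w[p + d]?)
    (φ : LTL k) (hty : ∀ ψ ∈ φ.subs, (SatAt w ψ i ↔ SatAt w ψ (i + d))) :
    (∀ p ≤ i, SatAt w' φ p ↔ SatAt w φ p) ∧ (∀ p, i < p → (SatAt w' φ p ↔ SatAt w φ (p + d))) := by
  induction φ with
  | tru => constructor <;> intro p hp <;> simp [SatAt, Sat] <;> omega
  | fls => constructor <;> intro p hp <;> simp [SatAt, Sat]
  | sym a =>
    have key : ∀ (v : List (Fin k)) p, SatAt v (.sym a) p ↔ v[p]? = some a := by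
      intro v p
      simp [SatAt, Sat, List.getElem?_eq_some_iff]
    constructor <;> intro p hp
    · rw [key, key, hle p hp]
    · rw [key, key, hgt p hp]
  | not φ ih =>
    have ih := ih (fun ψ h => hty ψ (by simp [subs, h]))
    have key : ∀ (v : List (Fin k)) p, SatAt v (.not φ) p ↔ p < v.length ∧ ¬ SatAt v φ p := by
      intro v p
      simp only [SatAt, Sat]
      constructor
      · rintro ⟨h, h'⟩; exact ⟨h, fun ⟨_, h''⟩ => h' h''⟩
      · rintro ⟨h, h'⟩; exact ⟨h, fun h'' => h' ⟨h, h''⟩⟩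
    constructor <;> intro p hp
    · rw [key, key, ih.1 p hp]
      exact and_congr_left fun _ => by omega
    · rw [key, key, ih.2 p hp]
      exact and_congr_left fun _ => by omega
  | and φ ψ ih1 ih2 =>
    have ih1 := ih1 (fun ψ h => hty ψ (by simp [subs, h]))
    have ih2 := ih2 (fun ψ h => hty ψ (by simp [subs, h]))
    have key : ∀ (v : List (Fin k)) p, SatAt v (.and φ ψ) p ↔ SatAt v φ p ∧ SatAt v ψ p := by
      intro v p
      simp only [SatAt, Sat]
      exact ⟨fun ⟨h, a, b⟩ => ⟨⟨h, a⟩, ⟨h, b⟩⟩, fun ⟨⟨h, a⟩, ⟨_, b⟩⟩ => ⟨h, a, b⟩⟩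
    constructor <;> intro p hp
    · rw [key, key, ih1.1 p hp, ih2.1 p hp]
    · rw [key, key, ih1.2 p hp, ih2.2 p hp]
  | or φ ψ ih1 ih2 =>
    have ih1 := ih1 (fun ψ h => hty ψ (by simp [subs, h]))
    have ih2 := ih2 (fun ψ h => hty ψ (by simp [subs, h]))
    have key : ∀ (v : List (Fin k)) p, SatAt v (.or φ ψ) p ↔ SatAt v φ p ∨ SatAt v ψ p := by
      intro v p
      simp only [SatAt, Sat]
      exact ⟨fun ⟨h, a⟩ => a.imp (⟨h, ·⟩) (⟨h, ·⟩),
        fun h => h.elim (fun ⟨h, a⟩ => ⟨h, .inl a⟩) (fun ⟨h, a⟩ => ⟨h, .inr a⟩)⟩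
    constructor <;> intro p hp
    · rw [key, key, ih1.1 p hp, ih2.1 p hp]
    · rw [key, key, ih1.2 p hp, ih2.2 p hp]
  | since φ ψ ih1 ih2 =>
    have ih1 := ih1 (fun ψ h => hty ψ (by simp [subs, h]))
    have ih2 := ih2 (fun ψ h => hty ψ (by simp [subs, h]))
    have hφ := hty φ (by simp [subs, self_mem_subs])
    have hψ := hty ψ (by simp [subs, self_mem_subs])
    have hs := hty (.since φ ψ) (self_mem_subs _)
    -- Up to `i` the two words have the same past, so forward induction suffices. The agreement of
    -- types is used only for the step from `i` to `i + 1`, where the past of `i` replaces that of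
    -- `i + d`.
    have A : ∀ p ≤ i, (SatAt w' (.since φ ψ) p ↔ SatAt w (.since φ ψ) p) := by
      intro p hp
      induction p with
      | zero => simp [not_satAt_since_zero]
      | succ p ihp =>
        rw [satAt_since w' _ _ _ (by omega), satAt_since w _ _ _ (by omega), ihp (by omega),
          ih1.1 p (by omega), ih2.1 p (by omega)]
    refine ⟨A, fun p hp => ?_⟩
    by_cases hp' : p < w'.length
    · obtain ⟨p, rfl⟩ : ∃ q, p = q + 1 := ⟨p - 1, by omega⟩
      induction p with
      | zero =>
        obtain rfl : i = 0 := by omega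
        rw [satAt_since w' _ _ _ hp', show 0 + 1 + d = (0 + d) + 1 by ring,
          satAt_since w _ _ _ (by omega), ih1.1 _ le_rfl, ih2.1 _ le_rfl, A _ le_rfl,
          hs, hφ, hψ]
      | succ p ihp =>
        rw [satAt_since w' _ _ _ hp', show p + 1 + 1 + d = (p + 1 + d) + 1 by ring,
          satAt_since w _ _ _ (by omega)]
        rcases Nat.lt_or_ge i (p + 1) with h | h
        · rw [ihp h (by omega), ih1.2 _ h, ih2.2 _ h]
        · obtain rfl : i = p + 1 := by omega
          rw [ih1.1 _ le_rfl, ih2.1 _ le_rfl, A _ le_rfl, hs, hφ, hψ]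
    · exact iff_of_false (not_satAt_of_le _ (by omega)) (not_satAt_of_le _ (by omega))
  | _ φ ψ ih1 ih2 =>
    have ih1 := ih1 (fun ψ h => hty ψ (by simp [subs, h]))
    have ih2 := ih2 (fun ψ h => hty ψ (by simp [subs, h]))
    -- The `until` case is dual: backward induction from the end of the word handles positions after
    -- `i`. At `i` itself the future is that of `i + d` in `w`, and the agreement of types moves the
    -- value back to `i`.
    have B : ∀ m p, i < p → w'.length ≤ p + m →
        (SatAt w' (.until φ ψ) p ↔ SatAt w (.until φ ψ) (p + d)) := by
      intro m
      induction m with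
      | zero =>
        intro p _ h
        exact iff_of_false (not_satAt_of_le _ (by omega)) (not_satAt_of_le _ (by omega))
      | succ m ihm =>
        intro p hp h
        rw [satAt_until w', satAt_until w, show p + d + 1 = p + 1 + d by ring,
          ihm (p + 1) (by omega) (by omega), ih1.2 _ (by omega), ih2.2 _ (by omega)]
    have B' := fun p hp => B w'.length p hp (by omega)
    have A : ∀ m p, p + m = i → (SatAt w' (.until φ ψ) p ↔ SatAt w (.until φ ψ) p) := by
      intro m
      induction m with
      | zero =>
        rintro p rfl
        rw [Nat.add_zero] at *
        rw [hty _ (self_mem_subs _), satAt_until w', satAt_until w, show p + d + 1 = p + 1 + d by ring,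
          B' _ (by omega), ih1.2 _ (by omega), ih2.2 _ (by omega)]
      | succ m ihm =>
        intro p hp
        rw [satAt_until w', satAt_until w, ihm (p + 1) (by omega), ih1.1 _ (by omega),
          ih2.1 _ (by omega)]
    exact ⟨fun p hp => A (i - p) p (by omega), B'⟩

end LTL

theorem LTLRecognizer.mem_language_iff {k : ℕ} (R : LTLRecognizer k) (w : List (Fin k)) :
    w ∈ R.language ↔ LTL.SatAt w R.formula
      (match R.out with | .first => 0 | .last => w.length - 1) := by
  obtain ⟨φ, o⟩ := R
  cases o
  · exact ⟨fun ⟨h, h'⟩ => ⟨h, h'⟩, fun ⟨h, h'⟩ => ⟨h, h'⟩⟩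
  · exact ⟨fun ⟨h, h'⟩ => ⟨Nat.sub_lt h Nat.one_pos, h'⟩, fun ⟨h, h'⟩ => ⟨by omega, h'⟩⟩

/-- A satisfiable formula has a model whose length is at most exponential in its size. -/
theorem LTLRecognizer.exists_short_word {k : ℕ} (R : LTLRecognizer k)
    (hne : ∃ w, w ∈ R.language) : ∃ w ∈ R.language, w.length ≤ 2 ^ R.size := by
  classical
  have hsub : R.formula.subs.length ≤ R.size := by
    have := R.formula.length_subs_le
    simp only [LTLRecognizer.size, List.length_append]; omega
  suffices H : ∀ n, ∀ w ∈ R.language, w.length = n →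
      ∃ w ∈ R.language, w.length ≤ 2 ^ R.formula.subs.length by
    obtain ⟨w, hw⟩ := hne
    obtain ⟨w', hw', h⟩ := H _ w hw rfl
    exact ⟨w', hw', h.trans (Nat.pow_le_pow_right (by norm_num) hsub)⟩
  intro n
  induction n using Nat.strong_induction_on with
  | _ n ih =>
  intro w hw hn
  by_cases hle : w.length ≤ 2 ^ R.formula.subs.length
  · exact ⟨w, hw, hle⟩
  -- The type of a position: which subformulas hold there. There are `2 ^ R.formula.subs.length`
  -- types, so a longer word repeats one.
  let ty : Fin w.length → Fin R.formula.subs.length → Bool :=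
    fun p q => decide (LTL.SatAt w (R.formula.subs.get q) p)
  obtain ⟨a, b, hab, hty⟩ := Fintype.exists_ne_map_eq_of_card_lt ty (by simp; omega)
  wlog hlt : a < b generalizing a b
  · exact this b a hab.symm hty.symm (lt_of_le_of_ne (not_lt.mp hlt) hab.symm)
  have hlt' : (a : ℕ) < b := hlt
  have hb := b.2
  obtain ⟨d, hd⟩ : ∃ d, (b : ℕ) = a + d := ⟨b - a, by omega⟩
  let w' := w.take (a + 1) ++ w.drop (b + 1)
  have htake : (w.take (a + 1)).length = a + 1 := by simp
  have hlen : w'.length + d = w.length := by simp [w']; omega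
  have hcut := LTL.satAt_cut w w' a d hlen (by simp [w']; omega)
    (fun p hp => by
      rw [List.getElem?_append_left (by omega), List.getElem?_take_of_lt (by omega)])
    (fun p hp => by
      rw [List.getElem?_append_right (by omega), htake, List.getElem?_drop]
      congr 1; omega)
    R.formula (fun ψ hψ => by
      obtain ⟨q, rfl⟩ := List.get_of_mem hψ
      have := congrFun hty q
      simp only [ty, decide_eq_decide] at this
      rw [this, hd])
  have hw' : w' ∈ R.language := by
    rw [LTLRecognizer.mem_language_iff] at hw ⊢
    have h0 : 0 < w'.length := by simp [w']
    obtain ⟨φ, o⟩ := R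
    cases o
    · exact (hcut.1 0 (Nat.zero_le _)).2 hw
    · simp only at hw hcut ⊢
      -- Either the last position survives the cut, or `b` was the last position and `a`, which has
      -- the same type, takes over its verdict. The first position always survives.
      rcases Nat.lt_or_ge a (w'.length - 1) with h | h
      · rw [hcut.2 _ h, show w'.length - 1 + d = w.length - 1 by omega]
        exact hw
      · rw [hcut.1 _ h]
        have h1 : w.length - 1 = b := by simp [w'] at h; omega
        have h2 : w'.length - 1 = a := by omega
        obtain ⟨q, hq⟩ := List.get_of_mem φ.self_mem_subs
        have := congrFun hty q
        simp only [ty, decide_eq_decide, hq] at this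
        rw [h2, this, ← h1]
        exact hw
  exact ih w'.length (by omega) w' hw' rfl


/-! ### A counter that logs its bit flips -/

/-- The value of the `K` lowest bits of `c`. -/
def bitValue (K : ℕ) (c : ℕ → Bool) : ℕ :=
  ∑ m ∈ Finset.range K, if c m then 2 ^ m else 0

theorem bitValue_update_true {K : ℕ} {c : ℕ → Bool} {m : ℕ} (hm : m < K) (h : c m = false) :
    bitValue K (Function.update c m true) = bitValue K c + 2 ^ m := by
  have hm' := Finset.mem_range.2 hm
  simp only [bitValue]
  rw [← Finset.add_sum_erase _ _ hm', ← Finset.add_sum_erase _ _ hm']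
  rw [Finset.sum_congr rfl (g := fun x => if c x then 2 ^ x else 0)]
  · simp [h, add_comm]
  · intro x hx
    rw [Function.update_of_ne (Finset.ne_of_mem_erase hx)]

theorem bitValue_update_false {K : ℕ} {c : ℕ → Bool} {m : ℕ} (hm : m < K) (h : c m = true) :
    bitValue K (Function.update c m false) + 2 ^ m = bitValue K c := by
  rw [← bitValue_update_true hm (c := Function.update c m false) (by simp)]
  simp [← h]

theorem bitValue_le (K : ℕ) (c : ℕ → Bool) : bitValue K c ≤ ∑ m ∈ Finset.range K, 2 ^ m :=
  Finset.sum_le_sum fun m _ => by split <;> simp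

/-- The counter: the stored bits and the address of the bit to be flipped next. -/
def counter : ℕ → (ℕ → Bool) × ℕ
  | 0 => (fun _ => false, 0)
  | i + 1 =>
    let (c, m) := counter i
    (Function.update c m (!c m), if c m then m + 1 else 0)

theorem counter_reaches (K : ℕ) :
    ∃ T, (counter T).2 = K ∧ ∀ i < T, (counter i).2 < K := by
  have hex : ∃ T, K ≤ (counter T).2 := by
    by_contra! hlt
    -- A potential that grows at every step. Clearing bit `m` leaves value plus `2 ^ m` unchanged
    -- and raises the address by one. Setting a bit raises that sum by one, and the weight `K + 1`
    -- outweighs the fall of the address to `0`. While addresses stay below `K` the potential is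
    -- bounded, a contradiction.
    have key : ∀ i, i ≤ (bitValue K (counter i).1 + 2 ^ (counter i).2) * (K + 1)
        + (counter i).2 := by
      intro i
      induction i with
      | zero => simp
      | succ i ih =>
        have hm := hlt i
        have hm' := hlt (i + 1)
        cases hc : (counter i).1 (counter i).2
        · simp only [counter, hc, Bool.not_false, Bool.false_eq_true, if_false]
          rw [bitValue_update_true hm hc]
          nlinarith
        · simp only [counter, hc, Bool.not_true, if_true]
          rw [← bitValue_update_false hm hc] at ih
          rw [pow_succ]
          nlinarith
    have h1 := key ((∑ m ∈ Finset.range K, 2 ^ m + 2 ^ K) * (K + 1) + K)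
    set i := (∑ m ∈ Finset.range K, 2 ^ m + 2 ^ K) * (K + 1) + K
    have h2 := bitValue_le K (counter i).1
    have h3 : 2 ^ (counter i).2 ≤ 2 ^ K := Nat.pow_le_pow_right (by norm_num) (hlt i).le
    have h4 := Nat.mul_le_mul_right (K + 1) (Nat.add_le_add h2 h3)
    have h5 := hlt i
    omega
  classical
  -- The address grows by at most one per step, so it equals `K` when it first reaches `K`.
  refine ⟨Nat.find hex, le_antisymm ?_ (Nat.find_spec hex), fun i hi => not_le.1 (Nat.find_min hex hi)⟩
  rcases h : Nat.find hex with _ | T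
  · simp [counter]
  · have := Nat.find_min hex (m := T) (by omega)
    simp only [counter]
    split <;> omega

/-! ### Flip logs as words -/

/-- The letters `0`, `1` are address bits. -/
def addrBit (a : Fin 4) : ℕ := if a = 1 then 1 else 0

/-- The letters `2`, `3` record that the bit at the address just read is set to `0`, `1`. -/
def IsEvent (a : Fin 4) : Prop := a = 2 ∨ a = 3

instance : DecidablePred IsEvent := fun a => inferInstanceAs (Decidable (a = 2 ∨ a = 3))

/-- The number written, least significant bit first, on the `n` positions before a position. -/
def addr (u : ℕ → Fin 4) : ℕ → ℕ → ℕ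
  | 0, _ => 0
  | _ + 1, 0 => 0
  | n + 1, p + 1 => addr u n p + 2 ^ n * addrBit (u p)

/-- The address at which a correct log continues. -/
def nextAddr (u : ℕ → Fin 4) (n : ℕ) : ℕ → ℕ
  | 0 => 0
  | p + 1 => if u p = 2 then addr u n p + 1 else if u p = 3 then 0 else nextAddr u n p

/-- The bits stored by the events before a position. -/
def memory (u : ℕ → Fin 4) (n : ℕ) : ℕ → ℕ → Bool
  | 0 => fun _ => false
  | p + 1 =>
    if IsEvent (u p) then Function.update (memory u n p) (addr u n p) (decide (u p = 3))
    else memory u n p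

/-- The letter at position `p` is consistent with a counter run. -/
def GoodAt (u : ℕ → Fin 4) (n p : ℕ) : Prop :=
  IsEvent (u p) → addr u n p = nextAddr u n p ∧ (u p = 3 ↔ memory u n p (addr u n p) = false)

theorem addr_lt (u : ℕ → Fin 4) (n p : ℕ) : addr u n p < 2 ^ n := by
  induction n generalizing p with
  | zero => simp [addr]
  | succ n ih =>
    cases p with
    | zero => simp [addr]
    | succ p =>
      have := ih p
      have h2 : addrBit (u p) ≤ 1 := by unfold addrBit; split <;> simp
      simp only [addr, pow_succ]
      nlinarith

/-- In a correct log, clearing bit `a` trades `2 ^ a` of stored value for an increase of `2 ^ a` in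
the second summand; setting it adds exactly one in total; other letters change nothing. So one
position buys at most one unit, and a high address can only occur late. -/
theorem bitValue_memory_le (u : ℕ → Fin 4) (n p : ℕ) (h : ∀ q < p, GoodAt u n q) :
    bitValue (2 ^ n) (memory u n p) + 2 ^ nextAddr u n p ≤ p + 1 := by
  induction p with
  | zero => simp [memory, nextAddr, bitValue]
  | succ p ih =>
    have ih := ih fun q hq => h q (by omega)
    have hg := h p (by omega)
    by_cases he : IsEvent (u p)
    · obtain ⟨h1, h2⟩ := hg he
      have hlt := addr_lt u n p
      rw [← h1] at ih
      rcases he with he' | he'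
      · have hm : memory u n p (addr u n p) = true := by
          simpa [he'] using h2
        simp only [memory, nextAddr, he', IsEvent]
        have := bitValue_update_false hlt hm
        simp [pow_succ]
        omega
      · have hm := h2.1 he'
        simp only [memory, nextAddr, he', IsEvent]
        have := bitValue_update_true hlt hm
        simp
        omega
    · have h2 : u p ≠ 2 := fun h => he (.inl h)
      have h3 : u p ≠ 3 := fun h => he (.inr h)
      simp only [memory, nextAddr, he, h2, h3, if_false]
      omega

/-- The log of the counter with addresses of `n` bits. -/
def counterLog (n : ℕ) (p : ℕ) : Fin 4 :=
  let (c, m) := counter (p / (n + 1))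
  if p % (n + 1) < n then (if m.testBit (p % (n + 1)) then 1 else 0)
  else if c m then 2 else 3

section counterLog
variable (n i : ℕ)

theorem counterLog_bit {t : ℕ} (ht : t < n) :
    counterLog n (i * (n + 1) + t) = if (counter i).2.testBit t then 1 else 0 := by
  have h1 : (i * (n + 1) + t) / (n + 1) = i := by
    rw [mul_comm, Nat.mul_add_div (by omega), Nat.div_eq_of_lt (by omega), add_zero]
  have h2 : (i * (n + 1) + t) % (n + 1) = t := by
    rw [mul_comm, Nat.mul_add_mod, Nat.mod_eq_of_lt (by omega)]
  simp only [counterLog, h1, h2, ht, if_true]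

theorem counterLog_event :
    counterLog n (i * (n + 1) + n) = if (counter i).1 (counter i).2 then 2 else 3 := by
  have h1 : (i * (n + 1) + n) / (n + 1) = i := by
    rw [mul_comm, Nat.mul_add_div (by omega), Nat.div_eq_of_lt (by omega), add_zero]
  have h2 : (i * (n + 1) + n) % (n + 1) = n := by
    rw [mul_comm, Nat.mul_add_mod, Nat.mod_eq_of_lt (by omega)]
  simp only [counterLog, h1, h2, lt_irrefl, if_false]

theorem not_isEvent_counterLog {t : ℕ} (ht : t < n) :
    ¬ IsEvent (counterLog n (i * (n + 1) + t)) := by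
  rw [counterLog_bit n i ht]
  split <;> simp [IsEvent]

theorem addr_counterLog {k : ℕ} (hk : k ≤ n) :
    addr (counterLog n) k (i * (n + 1) + k) = (counter i).2 % 2 ^ k := by
  induction k with
  | zero => simp [addr, Nat.mod_one]
  | succ k ih =>
    rw [← Nat.add_assoc, addr, ih (by omega), counterLog_bit n i (by omega),
      Nat.mod_pow_succ, Nat.testBit_eq_decide_div_mod_eq]
    rcases Nat.mod_two_eq_zero_or_one ((counter i).2 / 2 ^ k) with h | h <;> simp [addrBit, h]

/-- Only the last letter of each block of `n + 1` is an event, so the state is constant inside a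
block. The bound `h` ensures that the earlier addresses are not truncated to `n` bits. -/
theorem state_counterLog (h : ∀ j < i, (counter j).2 < 2 ^ n) {t : ℕ} (ht : t ≤ n) :
    memory (counterLog n) n (i * (n + 1) + t) = (counter i).1 ∧
      nextAddr (counterLog n) n (i * (n + 1) + t) = (counter i).2 := by
  induction i generalizing t with
  | zero =>
    induction t with
    | zero => simp [memory, nextAddr, counter]
    | succ t ih =>
      have h1 := not_isEvent_counterLog n 0 (t := t) (by omega)
      have h2 := h1
      simp only [IsEvent, not_or] at h2
      rw [← Nat.add_assoc, memory, nextAddr, if_neg h1, if_neg h2.1, if_neg h2.2]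
      exact ih (by omega)
  | succ i ihi =>
    induction t with
    | zero =>
      obtain ⟨h1, h2⟩ := ihi (fun j hj => h j (by omega)) (t := n) le_rfl
      have ha : addr (counterLog n) n (i * (n + 1) + n) = (counter i).2 := by
        rw [addr_counterLog n i le_rfl, Nat.mod_eq_of_lt (h i (by omega))]
      rw [show (i + 1) * (n + 1) + 0 = i * (n + 1) + n + 1 by ring, memory, nextAddr, ha, h1, h2,
        counterLog_event]
      cases hc : (counter i).1 (counter i).2 <;> simp [counter, hc, IsEvent]
    | succ t ih =>
      have h1 := not_isEvent_counterLog n (i + 1) (t := t) (by omega)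
      have h2 := h1
      simp only [IsEvent, not_or] at h2
      rw [← Nat.add_assoc, memory, nextAddr, if_neg h1, if_neg h2.1, if_neg h2.2]
      exact ih (by omega)

end counterLog

/-- The log of a counter run up to the first flip at the highest address. -/
theorem exists_goodLog (n : ℕ) : ∃ (u : ℕ → Fin 4) (N : ℕ),
    (∀ p ≤ N, GoodAt u n p) ∧ IsEvent (u N) ∧ addr u n N + 1 = 2 ^ n := by
  have hpos : 0 < 2 ^ n := by positivity
  obtain ⟨T, hT, hlt⟩ := counter_reaches (2 ^ n - 1)
  have hle : ∀ i ≤ T, (counter i).2 < 2 ^ n := by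
    intro i hi
    rcases hi.lt_or_eq with h | rfl
    · have := hlt i h; omega
    · omega
  have hev : ∀ i, IsEvent (counterLog n (i * (n + 1) + n)) := fun i => by
    rw [counterLog_event]; split <;> simp [IsEvent]
  refine ⟨counterLog n, T * (n + 1) + n, fun p hp he => ?_, hev T, ?_⟩
  · obtain ⟨i, t, ht, rfl⟩ : ∃ i t, t < n + 1 ∧ p = i * (n + 1) + t :=
      ⟨p / (n + 1), p % (n + 1), Nat.mod_lt _ (by omega), (Nat.div_add_mod' _ _).symm⟩
    obtain rfl : t = n := by
      by_contra h
      exact not_isEvent_counterLog n i (by omega) he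
    have hi : i ≤ T := by nlinarith
    obtain ⟨h1, h2⟩ := state_counterLog t i (fun j hj => hle j (by omega)) le_rfl
    rw [addr_counterLog t i le_rfl, Nat.mod_eq_of_lt (hle i hi), h1, h2, counterLog_event]
    refine ⟨rfl, ?_⟩
    cases (counter i).1 (counter i).2 <;> simp
  · rw [addr_counterLog n T le_rfl, Nat.mod_eq_of_lt (hle T le_rfl), hT]
    omega


/-! ### Building blocks of transformers -/

/-- The affine map `(x, y) ↦ P x + Q y + c`. -/
def affinePair {r s : ℕ} (P Q : Fin s → Fin r → ℚ) (c : Fin s → ℚ) : RatAffine (r + r) s :=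
  ⟨Matrix.of fun i => Fin.append (P i) (Q i), c⟩

theorem affinePair_app {r s : ℕ} (P Q : Fin s → Fin r → ℚ) (c : Fin s → ℚ) (x y : Fin r → ℚ)
    (i : Fin s) : (affinePair P Q c).app (Fin.append x y) i = P i ⬝ᵥ x + Q i ⬝ᵥ y + c i := by
  simp only [affinePair, RatAffine.app, Matrix.mulVec, dotProduct, Pi.add_apply, Matrix.of_apply,
    Fin.sum_univ_add, Fin.append_left, Fin.append_right]

/-- The zero map. -/
def zeroAffine (m n : ℕ) : RatAffine m n := ⟨0, 0⟩

theorem zeroAffine_app (m n : ℕ) (x : Fin m → ℚ) : (zeroAffine m n).app x = 0 := by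
  simp [zeroAffine, RatAffine.app]

theorem mem_maximizers {n : ℕ} {U : Finset (Fin n)} {S : Fin n → ℚ} {j : Fin n} :
    j ∈ maximizers U S ↔ j ∈ U ∧ ∀ j' ∈ U, S j' ≤ S j := Finset.mem_filter

theorem mem_unmasked_future {n : ℕ} {i j : Fin n} : j ∈ Mask.future.unmasked i ↔ j < i := by
  simp [Mask.unmasked]

theorem attentionVector_future_rightmost {r n : ℕ} (A B : RatAffine r r)
    (v : Fin n → Fin r → ℚ) (i : Fin n) :
    ((i : ℕ) = 0 ∧ attentionVector A B .future .rightmost v i = 0) ∨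
    ∃ j < i, attentionVector A B .future .rightmost v i = v j ∧ ∀ j' < i,
      A.app (v i) ⬝ᵥ B.app (v j') ≤ A.app (v i) ⬝ᵥ B.app (v j) ∧
      (j < j' → A.app (v i) ⬝ᵥ B.app (v j') < A.app (v i) ⬝ᵥ B.app (v j)) := by
  unfold attentionVector
  by_cases h : (Mask.future.unmasked i).Nonempty
  · right
    rw [dif_pos h]
    set S : Fin n → ℚ := fun j => A.app (v i) ⬝ᵥ B.app (v j)
    have hs := maximizers_nonempty S h
    obtain ⟨hlt, hmax⟩ := mem_maximizers.1 (Finset.max'_mem _ hs)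
    refine ⟨_, mem_unmasked_future.1 hlt, rfl, fun j' hj' =>
      ⟨hmax j' (mem_unmasked_future.2 hj'), fun hjj' => ?_⟩⟩
    refine lt_of_le_of_ne (hmax j' (mem_unmasked_future.2 hj')) fun heq => ?_
    exact absurd (Finset.le_max' _ j' (mem_maximizers.2 ⟨mem_unmasked_future.2 hj',
      fun q hq => (hmax q hq).trans_eq heq.symm⟩)) (not_le.2 hjj')
  · left
    rw [dif_neg h]
    refine ⟨?_, rfl⟩
    by_contra h0
    exact h ⟨⟨0, by omega⟩, mem_unmasked_future.2 (Nat.pos_of_ne_zero h0)⟩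

theorem attentionVector_none {r n : ℕ} (A B : RatAffine r r) (τ : TieBreak)
    (v : Fin n → Fin r → ℚ) (i : Fin n) :
    ∃ j, attentionVector A B .none τ v i = v j ∧ ∀ j',
      A.app (v i) ⬝ᵥ B.app (v j') ≤ A.app (v i) ⬝ᵥ B.app (v j) := by
  unfold attentionVector
  have h : (Mask.none.unmasked i).Nonempty := ⟨i, Finset.mem_univ i⟩
  rw [dif_pos h]
  set S : Fin n → ℚ := fun j => A.app (v i) ⬝ᵥ B.app (v j)
  have hs := maximizers_nonempty S h
  have hmem : τ.select _ hs ∈ maximizers (Mask.none.unmasked i) S := by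
    cases τ
    · exact Finset.min'_mem _ hs
    · exact Finset.max'_mem _ hs
  exact ⟨_, rfl, fun j' => (mem_maximizers.1 hmem).2 j' (Finset.mem_univ j')⟩

/-! ### Computing addresses

Coordinates: address bit, scale `2 ^ (-k)`, event flag, scaled flag of letter `3`, flag of letter
`2`, scaled address `x`, `x ^ 2`, address bit times `x`, scaled successor address at letter `2`. -/

/-- The embedding of a letter with scale `2 ^ (-k)` and scaled address `x`. -/
def addrVec (a : Fin 4) (k : ℕ) (m : ℕ) : Fin 9 → ℚ :=
  ![addrBit a, 1 / 2 ^ k, if IsEvent a then 1 else 0, if a = 3 then 1 / 2 ^ k else 0,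
    if a = 2 then 1 else 0, m / 2 ^ k, (m / 2 ^ k) ^ 2, addrBit a * (m / 2 ^ k),
    if a = 2 then (m + 1) / 2 ^ k else 0]

/-- Combines a vector with the vector of its predecessor. -/
def shiftAffine : RatAffine (9 + 9) 9 := affinePair
  ![![1, 0, 0, 0, 0, 0, 0, 0, 0],
    ![0, 1/2, 0, 0, 0, 0, 0, 0, 0],
    ![0, 0, 1, 0, 0, 0, 0, 0, 0],
    ![0, 0, 0, 1/2, 0, 0, 0, 0, 0],
    ![0, 0, 0, 0, 1, 0, 0, 0, 0],
    ![0, 0, 0, 0, 0, 0, 0, 0, 0],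
    ![0, 0, 0, 0, 0, 0, 0, 0, 0],
    ![1, 0, 0, 0, 0, 0, 0, 0, 0],
    ![0, 1/2, 0, 0, 1, 0, 0, 0, 0]]
  ![![0, 0, 0, 0, 0, 0, 0, 0, 0],
    ![0, 0, 0, 0, 0, 0, 0, 0, 0],
    ![0, 0, 0, 0, 0, 0, 0, 0, 0],
    ![0, 0, 0, 0, 0, 0, 0, 0, 0],
    ![0, 0, 0, 0, 0, 0, 0, 0, 0],
    ![1/2, 0, 0, 0, 0, 1/2, 0, 0, 0],
    ![1/4, 0, 0, 0, 0, 0, 1/4, 1/2, 0],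
    ![1/2, 0, 0, 0, 0, 1/2, 0, 0, 0],
    ![1/2, 0, 0, 0, 0, 1/2, 0, 0, 0]]
  ![0, 0, 0, 0, 0, 0, 0, -1, -1]

/-- `n` rounds of shifting, followed by `L`. -/
def shiftLayers {e : ℕ} (L : Layers 9 e) : ℕ → Layers 9 e
  | 0 => L
  | n + 1 => .attention (by norm_num) (zeroAffine 9 9) (zeroAffine 9 9) shiftAffine .future
      .rightmost (.relu 7 (.relu 8 (shiftLayers L n)))

/-- With zero query and key all scores tie, and rightmost tie-breaking under the mask `j < i` picks
the predecessor. -/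
theorem attentionVector_pred {r N : ℕ} (v : Fin N → Fin r → ℚ) (p : ℕ) (hp : p < N) :
    attentionVector (zeroAffine r r) (zeroAffine r r) .future .rightmost v ⟨p, hp⟩ =
      if h : p = 0 then 0 else v ⟨p - 1, by omega⟩ := by
  rcases attentionVector_future_rightmost (zeroAffine r r) (zeroAffine r r) v ⟨p, hp⟩ with
    ⟨h, h'⟩ | ⟨j, hj, h, h'⟩
  · rw [h', dif_pos h]
  · have hj' : (j : ℕ) < p := hj
    rw [dif_neg (by omega), h]
    congr 1
    ext
    by_contra hne
    simp only at hne
    have := (h' ⟨p - 1, by omega⟩ (by simp [Fin.lt_def]; omega)).2 (by simp [Fin.lt_def]; omega)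
    simp [zeroAffine_app] at this

/-- If the predecessor has bit `b` and scaled address `x`, the new scaled address is `(b + x) / 2`,
with square `(b + x² + 2bx) / 4` because `b² = b`. The product needed in the next round comes from
ReLU: `b * x = max 0 (b + x - 1)` for a bit `b` and `0 ≤ x ≤ 1`. The successor address is gated by
the flag of letter `2` in the same way. At position `0` the default attention vector `0` gives the
right address `0`. -/
theorem shift_step {u : ℕ → Fin 4} {k p : ℕ} {a : Fin 9 → ℚ}
    (ha : a = if p = 0 then 0 else addrVec (u (p - 1)) k (addr u k (p - 1))) :
    (fun x : Fin 9 → ℚ => Function.update x 8 (max 0 (x 8)))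
      ((fun x : Fin 9 → ℚ => Function.update x 7 (max 0 (x 7)))
        (shiftAffine.app (Fin.append (addrVec (u p) k (addr u k p)) a))) =
      addrVec (u p) (k + 1) (addr u (k + 1) p) := by
  have hinv : ((2 : ℚ) ^ (k + 1))⁻¹ = 2⁻¹ * (2 ^ k)⁻¹ := by rw [pow_succ, mul_inv, mul_comm]
  have h5 : a 0 / 2 + a 5 / 2 = (addr u (k + 1) p : ℚ) / 2 ^ (k + 1) := by
    subst ha
    rcases p with _ | p
    · simp [addr]
    · simp [addr, addrVec]
      field_simp
      ring
  have h6 : a 0 / 4 + a 6 / 4 + a 7 / 2 = ((addr u (k + 1) p : ℚ) / 2 ^ (k + 1)) ^ 2 := by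
    rw [← h5]
    subst ha
    rcases p with _ | p
    · simp
    · have hb : (addrBit (u p) : ℚ) ^ 2 = addrBit (u p) := by
        unfold addrBit; split <;> simp
      simp [addrVec]
      linear_combination (-1 / 4 : ℚ) * hb
  have hlt : (addr u (k + 1) p : ℚ) + 1 ≤ 2 ^ (k + 1) := by
    exact_mod_cast addr_lt u (k + 1) p
  have hle1 : ((addr u (k + 1) p : ℚ) + 1) / 2 ^ (k + 1) ≤ 1 := by
    rw [div_le_one (by positivity)]; exact hlt
  have hd : (0 : ℚ) < 1 / 2 ^ (k + 1) := by positivity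
  have h0 : (0 : ℚ) ≤ (addr u (k + 1) p : ℚ) / 2 ^ (k + 1) := by positivity
  generalize hm : addr u (k + 1) p = m at *
  have e0 : shiftAffine.app (Fin.append (addrVec (u p) k (addr u k p)) a) =
    ![(addrBit (u p) : ℚ), 1 / 2 ^ (k + 1), if IsEvent (u p) then 1 else 0,
      if u p = 3 then 1 / 2 ^ (k + 1) else 0, if u p = 2 then 1 else 0, m / 2 ^ (k + 1),
      (m / 2 ^ (k + 1)) ^ 2, addrBit (u p) + m / 2 ^ (k + 1) - 1,
      1 / 2 ^ (k + 1) + (if u p = 2 then 1 else 0) + m / 2 ^ (k + 1) - 1] := by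
    ext i
    rw [shiftAffine, affinePair_app]
    rw [← h6, ← h5]
    fin_cases i
    all_goals simp [dotProduct, Fin.sum_univ_succ, addrVec]
    · exact hinv.symm
    · rw [hinv]
    · ring
    · ring
    · ring
    · rw [hinv]; ring
  rw [e0]
  clear e0
  ext i
  fin_cases i <;> simp [addrVec, Function.update]
  · have hle : (m : ℚ) / 2 ^ (k + 1) ≤ 1 := by
      rw [add_div] at hle1; linarith
    unfold addrBit
    split
    · rw [max_eq_right] <;> push_cast <;> linarith
    · rw [max_eq_left] <;> push_cast <;> linarith
  · rw [add_div, one_div] at hle1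
    rw [one_div] at hd
    split
    · rw [max_eq_right (by linarith), add_div, one_div]; ring
    · rw [max_eq_left (by linarith)]

theorem shiftLayers_run {e N : ℕ} (L : Layers 9 e) (u : ℕ → Fin 4) (n k : ℕ) :
    (shiftLayers L n).run (fun i : Fin N => addrVec (u i) k (addr u k i)) =
      L.run (fun i : Fin N => addrVec (u i) (k + n) (addr u (k + n) i)) := by
  induction n generalizing k with
  | zero => rfl
  | succ n ih =>
    rw [show k + (n + 1) = (k + 1) + n by ring, ← ih (k + 1)]
    simp only [shiftLayers, Layers.run]
    congr 1
    funext i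
    refine shift_step ?_
    rw [attentionVector_pred _ i i.2]
    split <;> simp


/-! ### Checking a log -/

theorem nextAddr_eq_of_no_event {u : ℕ → Fin 4} {n j p : ℕ} (hjp : j ≤ p)
    (h : ∀ q, j ≤ q → q < p → ¬ IsEvent (u q)) : nextAddr u n p = nextAddr u n j := by
  induction p, hjp using Nat.le_induction with
  | base => rfl
  | succ p hp ih =>
    have h1 := h p hp (by omega)
    simp only [IsEvent, not_or] at h1
    rw [nextAddr, if_neg h1.1, if_neg h1.2, ih fun q h2 h3 => h q h2 (by omega)]

theorem memory_eq_of_no_match {u : ℕ → Fin 4} {n j p x : ℕ} (hjp : j ≤ p)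
    (h : ∀ q, j ≤ q → q < p → IsEvent (u q) → addr u n q ≠ x) :
    memory u n p x = memory u n j x := by
  induction p, hjp using Nat.le_induction with
  | base => rfl
  | succ p hp ih =>
    rw [memory, ← ih fun q h2 h3 => h q h2 (by omega)]
    split
    · rename_i he
      rw [Function.update_of_ne (h p hp (by omega) he).symm]
    · rfl

theorem nextAddr_le (u : ℕ → Fin 4) (n p : ℕ) : nextAddr u n p ≤ 2 ^ n := by
  induction p with
  | zero => simp [nextAddr]
  | succ p ih =>
    have := addr_lt u n p
    rw [nextAddr]
    split
    · omega
    · split <;> omega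

/-- The affine map with first coordinate `x ↦ f x + a`, second coordinate `x ↦ g x + b`, and all
others `0`. -/
def twoRows {m : ℕ} (f g : Fin (m + 2) → ℚ) (a b : ℚ) : RatAffine (m + 2) (m + 2) :=
  ⟨Matrix.of (Fin.cons f (Fin.cons g fun _ => 0)), Fin.cons a (Fin.cons b fun _ => 0)⟩

theorem twoRows_app_dotProduct {m : ℕ} (f g f' g' : Fin (m + 2) → ℚ) (a b a' b' : ℚ)
    (x y : Fin (m + 2) → ℚ) :
    (twoRows f g a b).app x ⬝ᵥ (twoRows f' g' a' b').app y =
      (f ⬝ᵥ x + a) * (f' ⬝ᵥ y + a') + (g ⬝ᵥ x + b) * (g' ⬝ᵥ y + b') := by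
  rw [dotProduct, Fin.sum_univ_succ, Fin.sum_univ_succ, Finset.sum_eq_zero]
  · simp [twoRows, RatAffine.app, Matrix.mulVec]
  · intro i _
    have : (twoRows f g a b).app x i.succ.succ = 0 := by
      simp [twoRows, RatAffine.app, Matrix.mulVec, dotProduct]
    rw [this, zero_mul]

/-- Attends to the last event. -/
def eventQuery : RatAffine 9 9 := twoRows (m := 7) 0 0 1 0

def eventKey : RatAffine 9 9 := twoRows (m := 7) ![0, 0, 1, 0, 0, 0, 0, 0, 0] 0 0 0

theorem eventScore (x y : Fin 9 → ℚ) : eventQuery.app x ⬝ᵥ eventKey.app y = y 2 := by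
  rw [eventQuery, eventKey, twoRows_app_dotProduct]
  simp [dotProduct, Fin.sum_univ_succ]

/-- Compares the address with the one expected after the last event. -/
def eventValue : RatAffine (9 + 9) 8 := affinePair
  ![![0, 1, 0, 0, 0, 0, 0, 0, 0],
    ![0, 0, 1, 0, 0, 0, 0, 0, 0],
    ![0, 0, 0, 1, 0, 0, 0, 0, 0],
    ![0, 0, 0, 0, 1, 0, 0, 0, 0],
    ![0, 0, 0, 0, 0, 1, 0, 0, 0],
    ![0, 0, 0, 0, 0, 0, 1, 0, 0],
    ![0, 0, 0, 0, 0, 1, 0, 0, 0],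
    ![0, 0, 0, 0, 0, -1, 0, 0, 0]]
  ![0, 0, 0, 0, 0, 0, ![0, 0, 0, 0, 0, 0, 0, 0, -1], ![0, 0, 0, 0, 0, 0, 0, 0, 1]]
  0

theorem eventValue_app (x y : Fin 9 → ℚ) : eventValue.app (Fin.append x y) =
    ![x 1, x 2, x 3, x 4, x 5, x 6, x 5 - y 8, y 8 - x 5] := by
  ext i
  rw [eventValue, affinePair_app]
  fin_cases i <;> simp [dotProduct, Fin.sum_univ_succ] <;> ring

/-- Attends to the last event with the same address. -/
def matchQuery : RatAffine 8 8 := twoRows (m := 6) ![0, 0, 0, 0, 2, 0, 0, 0] 0 0 1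

def matchKey : RatAffine 8 8 :=
  twoRows (m := 6) ![0, 0, 0, 0, 1, 0, 0, 0] ![0, 1, 0, 0, 0, -1, 0, 0] 0 0

theorem matchScore (x y : Fin 8 → ℚ) :
    matchQuery.app x ⬝ᵥ matchKey.app y = 2 * x 4 * y 4 + y 1 - y 5 := by
  rw [matchQuery, matchKey, twoRows_app_dotProduct]
  simp [dotProduct, Fin.sum_univ_succ]
  ring

/-- Compares the address with the one found. -/
def matchValue : RatAffine (8 + 8) 9 := affinePair
  ![![1, 0, 0, 0, 0, 0, 0, 0],
    ![0, 1, 0, 0, 0, 0, 0, 0],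
    ![0, 0, 1, 0, 0, 0, 0, 0],
    ![0, 0, 0, 1, 0, 0, 0, 0],
    ![0, 0, 0, 0, 1, 0, 0, 0],
    ![0, 0, 0, 0, 0, 0, 1, 1],
    0,
    ![0, 0, 0, 0, 1, 0, 0, 0],
    ![0, 0, 0, 0, -1, 0, 0, 0]]
  ![0, 0, 0, 0, 0, 0, ![0, 0, 1, 0, 0, 0, 0, 0], ![0, 0, 0, 0, -1, 0, 0, 0],
    ![0, 0, 0, 0, 1, 0, 0, 0]]
  0

theorem matchValue_app (x y : Fin 8 → ℚ) : matchValue.app (Fin.append x y) =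
    ![x 0, x 1, x 2, x 3, x 4, x 6 + x 7, y 2, x 4 - y 4, y 4 - x 4] := by
  ext i
  rw [matchValue, affinePair_app]
  fin_cases i <;> simp [dotProduct, Fin.sum_univ_succ] <;> ring

/-- Restricts the checks to the relevant letters. -/
def gateValue : RatAffine (9 + 9) 6 := affinePair
  ![![1, 0, 0, 0, 0, 0, 0, 0, 0],
    ![0, 1, 0, 0, 0, 0, 0, 0, 0],
    ![0, 0, 0, 0, 1, 0, 0, 0, 0],
    ![0, 1, 0, 0, 0, 1, 0, 0, 0],
    ![-1, 0, 1, 0, 0, 0, 1, -1, -1],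
    ![1, 0, 0, 2, 0, 0, -1, 1, 1]]
  0
  ![0, 0, 0, -1, 0, -2]

theorem gateValue_app (x y : Fin 9 → ℚ) : gateValue.app (Fin.append x y) =
    ![x 0, x 1, x 4, x 5 - 1 + x 1, x 6 - (x 7 + x 8) - x 0 + x 2,
      x 0 - x 6 + (x 7 + x 8) - 2 + 2 * x 3] := by
  ext i
  rw [gateValue, affinePair_app]
  fin_cases i <;> simp [dotProduct, Fin.sum_univ_succ] <;> ring

/-- Attends to a position with the largest violation. -/
def violationQuery : RatAffine 6 6 := twoRows (m := 4) 0 0 1 0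

def violationKey : RatAffine 6 6 := twoRows (m := 4) ![0, 0, 0, 1, 1, 1] 0 0 0

theorem violationScore (x y : Fin 6 → ℚ) :
    violationQuery.app x ⬝ᵥ violationKey.app y = y 3 + y 4 + y 5 := by
  rw [violationQuery, violationKey, twoRows_app_dotProduct]
  simp [dotProduct, Fin.sum_univ_succ]
  ring

def verdictValue : RatAffine (6 + 6) 1 := affinePair
  ![![3/2, 2, 1, 0, 0, 0]] ![![0, 0, 0, -1, -1, -1]] ![-3]

theorem verdictValue_app (x y : Fin 6 → ℚ) : verdictValue.app (Fin.append x y) 0 =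
    x 2 + 3 / 2 * x 0 + 2 * x 1 - 3 - (y 3 + y 4 + y 5) := by
  rw [verdictValue, affinePair_app]
  simp [dotProduct, Fin.sum_univ_succ]
  ring

/-- The last layer: subtracts the largest violation. -/
def verdictLayers : Layers 6 1 :=
  .attention (by norm_num) violationQuery violationKey verdictValue .none .leftmost .nil

/-- The layers that combine the results of the checks. -/
def gateLayers : Layers 9 1 :=
  .attention (by norm_num) (zeroAffine 9 9) (zeroAffine 9 9) gateValue .future .rightmost <|
  .relu 3 <| .relu 4 <| .relu 5 verdictLayers

/-- The layers that check the letters of a log. -/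
def matchLayers : Layers 8 1 :=
  .attention (by norm_num) matchQuery matchKey matchValue .future .rightmost <|
  .relu 7 <| .relu 8 gateLayers

/-- The layers that check a log once the addresses have been computed. -/
def checkLayers : Layers 9 1 :=
  .attention (by norm_num) eventQuery eventKey eventValue .future .rightmost <|
  .relu 6 <| .relu 7 matchLayers

/-! ### What the checking layers compute -/

section checkLayers
variable (u : ℕ → Fin 4) (n N : ℕ)

/-- The scaled address at a position. -/
def scaledAddr (p : ℕ) : ℚ := addr u n p / 2 ^ n

/-- The vectors after the first check. -/
def eventVec (p : ℕ) : Fin 8 → ℚ :=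
  ![1 / 2 ^ n, if IsEvent (u p) then 1 else 0, if u p = 3 then 1 / 2 ^ n else 0,
    if u p = 2 then 1 else 0, scaledAddr u n p, scaledAddr u n p ^ 2,
    max 0 (scaledAddr u n p - nextAddr u n p / 2 ^ n),
    max 0 (nextAddr u n p / 2 ^ n - scaledAddr u n p)]

/-- The violation at a position where the match attention has found the scaled flag `h` and the
scaled address `s`. -/
def violation (h s : ℚ) (p : ℕ) : Fin 3 → ℚ :=
  ![max 0 (|scaledAddr u n p - nextAddr u n p / 2 ^ n| - 1 + if IsEvent (u p) then 1 else 0),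
    max 0 (h - |scaledAddr u n p - s| - 1 / 2 ^ n + if u p = 3 then 1 / 2 ^ n else 0),
    max 0 (1 / 2 ^ n - h + |scaledAddr u n p - s| - 2 + 2 * if u p = 2 then 1 else 0)]

variable {u n N}

/-- Maximizing the event flag with rightmost ties finds the last event. Coordinate `8` holds the
successor address for letter `2` and `0` for any other letter, so it is also right after letter `3`
and when there is no earlier event. -/
theorem event_attention (i : Fin N) :
    attentionVector eventQuery eventKey .future .rightmost
      (fun i : Fin N => addrVec (u i) n (addr u n i)) i 8 = nextAddr u n i / 2 ^ n := by
  rcases attentionVector_future_rightmost eventQuery eventKey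
    (fun i : Fin N => addrVec (u i) n (addr u n i)) i with ⟨h0, h⟩ | ⟨j, hj, h, hmax⟩
  · simp [h, h0, nextAddr]
  · rw [h]
    simp only [eventScore] at hmax
    have hmax' : ∀ q : ℕ, q < i →
        (if IsEvent (u q) then (1 : ℚ) else 0) ≤ (if IsEvent (u j) then (1 : ℚ) else 0) ∧
        ((j : ℕ) < q →
          (if IsEvent (u q) then (1 : ℚ) else 0) < (if IsEvent (u j) then (1 : ℚ) else 0)) :=
      fun q hq => hmax ⟨q, by omega⟩ hq
    have hj' : (j : ℕ) < i := hj
    by_cases he : IsEvent (u j)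
    · rw [nextAddr_eq_of_no_event (j := j + 1) hj' fun q h1 h2 hq => by
        have := (hmax' q h2).2 h1
        simp [hq, he] at this]
      rw [nextAddr]
      rcases he with he | he <;> simp [addrVec, he]
    · rw [nextAddr_eq_of_no_event (j := 0) (Nat.zero_le _) fun q h1 h2 hq => by
        have := (hmax' q h2).1
        simp [hq, he] at this
        linarith]
      have h2 : u j ≠ 2 := fun h => he (.inl h)
      simp [addrVec, nextAddr, h2]

/-- Up to the constant `x²`, the score is the event flag minus `(x - y)²`; it reaches its upper
bound `1` exactly at events with the same address, and the rightmost of these is the last write. If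
there is none, the position found is arbitrary. Hence the found address `m` must still be compared:
the stored bit is `1` iff letter `3` was found at the right address. -/
theorem match_attention (i : Fin N) : ∃ (b : Bool) (m : ℕ), m < 2 ^ n ∧
    attentionVector matchQuery matchKey .future .rightmost
      (fun i : Fin N => eventVec u n i) i 2 = (if b then 1 / 2 ^ n else 0) ∧
    attentionVector matchQuery matchKey .future .rightmost
      (fun i : Fin N => eventVec u n i) i 4 = m / 2 ^ n ∧
    (memory u n i (addr u n i) = true ↔ b = true ∧ m = addr u n i) := by
  rcases attentionVector_future_rightmost matchQuery matchKey
    (fun i : Fin N => eventVec u n i) i with ⟨h0, h⟩ | ⟨j, hj, h, hmax⟩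
  · exact ⟨false, 0, by positivity, by simp [h, h0, memory]⟩
  refine ⟨decide (u j = 3), addr u n j, addr_lt u n j, by rw [h]; simp [eventVec],
    by rw [h]; simp [eventVec, scaledAddr], ?_⟩
  simp only [matchScore] at hmax
  have hj' : (j : ℕ) < i := hj
  have hinj : ∀ p q, scaledAddr u n p = scaledAddr u n q → addr u n p = addr u n q := by
    intro p q hpq
    have h2 : (2 : ℚ) ^ n ≠ 0 := by positivity
    rw [scaledAddr, scaledAddr, div_left_inj' h2] at hpq
    exact_mod_cast hpq
  have hmax' : ∀ q : ℕ, q < i →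
      2 * scaledAddr u n i * scaledAddr u n q + (if IsEvent (u q) then 1 else 0) -
        scaledAddr u n q ^ 2 ≤
      2 * scaledAddr u n i * scaledAddr u n j + (if IsEvent (u j) then 1 else 0) -
        scaledAddr u n j ^ 2 ∧
      ((j : ℕ) < q →
        2 * scaledAddr u n i * scaledAddr u n q + (if IsEvent (u q) then 1 else 0) -
          scaledAddr u n q ^ 2 <
        2 * scaledAddr u n i * scaledAddr u n j + (if IsEvent (u j) then 1 else 0) -
          scaledAddr u n j ^ 2) :=
    fun q hq => hmax ⟨q, by omega⟩ hq
  by_cases hm : IsEvent (u j) ∧ addr u n j = addr u n i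
  · obtain ⟨he, ha⟩ := hm
    have hs : scaledAddr u n j = scaledAddr u n i := by rw [scaledAddr, ha, scaledAddr]
    rw [memory_eq_of_no_match (j := j + 1) hj' fun q h1 h2 hq hqa => by
      have := (hmax' q h2).2 h1
      have hs' : scaledAddr u n q = scaledAddr u n i := by rw [scaledAddr, hqa, scaledAddr]
      simp [hq, he, hs, hs'] at this]
    rw [memory, if_pos he, ha]
    simp
  · rw [memory_eq_of_no_match (j := 0) (Nat.zero_le _) fun q h1 h2 hq hqa => by
      have := (hmax' q h2).1
      have hs' : scaledAddr u n q = scaledAddr u n i := by rw [scaledAddr, hqa, scaledAddr]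
      rw [hs', if_pos hq] at this
      by_cases he : IsEvent (u j)
      · rw [if_pos he] at this
        -- An event that scores at least as high as a match is itself a match.
        have h0 : (scaledAddr u n j - scaledAddr u n i) ^ 2 = 0 := by
          nlinarith [sq_nonneg (scaledAddr u n j - scaledAddr u n i)]
        exact hm ⟨he, hinj _ _ (sub_eq_zero.1 (pow_eq_zero_iff two_ne_zero |>.1 h0))⟩
      · rw [if_neg he] at this
        nlinarith [sq_nonneg (scaledAddr u n j - scaledAddr u n i)]]
    simp only [memory, Bool.false_eq_true, decide_eq_true_eq, false_iff, not_and]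
    exact fun h3 ha => hm ⟨.inr h3, ha⟩

theorem max_zero_add_max_zero (x y : ℚ) : max 0 (x - y) + max 0 (y - x) = |x - y| := by
  rcases le_total x y with h | h
  · rw [max_eq_left (by linarith), max_eq_right (by linarith), abs_of_nonpos (by linarith)]
    ring
  · rw [max_eq_right (by linarith), max_eq_left (by linarith), abs_of_nonneg (by linarith)]
    ring

/-- The pair `b j`, `m j` is what the match attention retrieves at `j`; the position `j` in the
output formula is where the unmasked last layer finds the largest total violation. -/
theorem checkLayers_run (i : Fin N) : ∃ (b : Fin N → Bool) (m : Fin N → ℕ),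
    (∀ j, m j < 2 ^ n ∧ (memory u n j (addr u n j) = true ↔ b j = true ∧ m j = addr u n j)) ∧
    ∃ j : Fin N,
      checkLayers.run (fun i : Fin N => addrVec (u i) n (addr u n i)) i 0 =
        scaledAddr u n i + 3 / 2 * (1 / 2 ^ n) + 2 * (if IsEvent (u i) then 1 else 0) - 3 -
          ∑ t, violation u n (if b j then 1 / 2 ^ n else 0) (m j / 2 ^ n) j t ∧
      ∀ j', ∑ t, violation u n (if b j' then 1 / 2 ^ n else 0) (m j' / 2 ^ n) j' t ≤
        ∑ t, violation u n (if b j then 1 / 2 ^ n else 0) (m j / 2 ^ n) j t := by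
  choose b m hm hb2 hb4 hb using match_attention (u := u) (n := n) (N := N)
  refine ⟨b, m, fun j => ⟨hm j, hb j⟩, ?_⟩
  have e1 : checkLayers.run (fun i : Fin N => addrVec (u i) n (addr u n i)) =
      matchLayers.run (fun i : Fin N => eventVec u n i) := by
    refine congrArg matchLayers.run (funext fun i => ?_)
    simp only [eventValue_app, event_attention]
    ext t
    fin_cases t <;> simp [eventVec, addrVec, scaledAddr, Function.update]
  have e3 : matchLayers.run (fun i : Fin N => eventVec u n i) =
      gateLayers.run (fun i : Fin N => ![1 / 2 ^ n, if IsEvent (u i) then 1 else 0,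
        if u i = 3 then 1 / 2 ^ n else 0, if u i = 2 then 1 else 0, scaledAddr u n i,
        |scaledAddr u n i - nextAddr u n i / 2 ^ n|, if b i then 1 / 2 ^ n else 0,
        max 0 (scaledAddr u n i - m i / 2 ^ n), max 0 (m i / 2 ^ n - scaledAddr u n i)]) := by
    refine congrArg gateLayers.run (funext fun i => ?_)
    simp only [matchValue_app, hb2, hb4]
    ext t
    fin_cases t <;> simp [eventVec, Function.update, max_zero_add_max_zero]
  rw [e1, e3, gateLayers]
  set V : Fin N → Fin 3 → ℚ :=
    fun j => violation u n (if b j then 1 / 2 ^ n else 0) (m j / 2 ^ n) j with hV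
  have e2 : ∀ (x : Fin N → Fin 6 → ℚ), (∀ j, x j = ![1 / 2 ^ n, if IsEvent (u j) then 1 else 0,
      scaledAddr u n j, V j 0, V j 1, V j 2]) →
      ∃ j, verdictLayers.run x i 0 = scaledAddr u n i + 3 / 2 * (1 / 2 ^ n) +
          2 * (if IsEvent (u i) then 1 else 0) - 3 - ∑ t, V j t ∧
        ∀ j', ∑ t, V j' t ≤ ∑ t, V j t := by
    intro x hx
    obtain ⟨j, hj, hmax⟩ := attentionVector_none violationQuery violationKey .leftmost x i
    refine ⟨j, ?_, fun j' => ?_⟩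
    · rw [verdictLayers, Layers.run, Layers.run, verdictValue_app, hj, hx, hx]
      simp [Fin.sum_univ_three]
    · have := hmax j'
      rw [violationScore, violationScore, hx, hx] at this
      simpa [Fin.sum_univ_three] using this
  simp only [Layers.run, gateValue_app]
  refine e2 _ fun j => ?_
  ext t
  fin_cases t <;> simp [Function.update, hV, violation, max_zero_add_max_zero]

end checkLayers


/-! ### Violations separate correct from incorrect letters -/

section violation
variable {u : ℕ → Fin 4} {n p m : ℕ} {b : Bool}

theorem scaled_abs_sub_le_one {n a m : ℕ} (ha : a ≤ 2 ^ n) (hm : m ≤ 2 ^ n) :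
    |(a : ℚ) / 2 ^ n - m / 2 ^ n| ≤ 1 := by
  have ha' : (a : ℚ) / 2 ^ n ≤ 1 := by
    rw [div_le_one (by positivity)]; exact_mod_cast ha
  have hm' : (m : ℚ) / 2 ^ n ≤ 1 := by
    rw [div_le_one (by positivity)]; exact_mod_cast hm
  have h1 : (0 : ℚ) ≤ a / 2 ^ n := by positivity
  have h2 : (0 : ℚ) ≤ m / 2 ^ n := by positivity
  rw [abs_le]
  constructor <;> linarith

theorem le_scaled_abs_sub {n a m : ℕ} (h : a ≠ m) :
    (1 : ℚ) / 2 ^ n ≤ |(a : ℚ) / 2 ^ n - m / 2 ^ n| := by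
  rw [← sub_div, abs_div, abs_of_pos (by positivity : (0 : ℚ) < 2 ^ n)]
  gcongr
  have : (1 : ℤ) ≤ |(a : ℤ) - m| := Int.one_le_abs (by omega)
  exact_mod_cast this

theorem violation_nonneg (h s : ℚ) : 0 ≤ ∑ t, violation u n h s p t := by
  simp only [Fin.sum_univ_three, violation]
  simp
  positivity

/-- Scaled distances are at most `1` and retrieved flags at most `2 ^ (-n)`, so the subtracted
constants switch each summand off at letters it does not concern. Where a summand is active,
correctness makes the remaining expression nonpositive. -/
theorem violation_eq_zero (hm : m < 2 ^ n)
    (hb : memory u n p (addr u n p) = true ↔ b = true ∧ m = addr u n p) (hg : GoodAt u n p) :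
    ∑ t, violation u n (if b then 1 / 2 ^ n else 0) (m / 2 ^ n) p t = 0 := by
  have hlt := addr_lt u n p
  have h1 := scaled_abs_sub_le_one hlt.le (nextAddr_le u n p)
  have h2 := scaled_abs_sub_le_one hlt.le hm.le
  have h3 := abs_nonneg ((addr u n p : ℚ) / 2 ^ n - m / 2 ^ n)
  have hd : (0 : ℚ) < 1 / 2 ^ n := by positivity
  have hd1 : (1 : ℚ) / 2 ^ n ≤ 1 := by
    rw [div_le_one (by positivity)]; exact one_le_pow₀ (by norm_num)
  have hh : (if b = true then (1 : ℚ) / 2 ^ n else 0) ≤ 1 / 2 ^ n := by split <;> linarith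
  have hh0 : (0 : ℚ) ≤ (if b = true then (1 : ℚ) / 2 ^ n else 0) := by split <;> linarith
  have hne : (2 : Fin 4) ≠ 3 := by decide
  simp only [Fin.sum_univ_three, violation, scaledAddr]
  simp only [Matrix.cons_val]
  by_cases he : IsEvent (u p)
  · obtain ⟨g1, g2⟩ := hg he
    rcases he with he' | he'
    · have hmem : memory u n p (addr u n p) = true := by simpa [he'] using g2
      obtain ⟨hb1, hb2⟩ := hb.1 hmem
      simp [he', IsEvent, ← g1, hb1, hb2, hne]
    · have hmem : ¬ memory u n p (addr u n p) = true := by simp [g2.1 he']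
      have hV2 : (if b = true then (1 : ℚ) / 2 ^ n else 0) ≤
          |(addr u n p : ℚ) / 2 ^ n - m / 2 ^ n| := by
        split
        · rename_i hbt
          exact le_scaled_abs_sub fun h => hmem (hb.2 ⟨hbt, h.symm⟩)
        · exact h3
      rw [max_eq_left, max_eq_left, max_eq_left]
      · norm_num
      · simp only [he', hne.symm, if_false]; linarith
      · simp only [he', if_true]; linarith
      · simp [he', IsEvent, ← g1]
  · have e2 : u p ≠ 2 := fun h => he (.inl h)
    have e3 : u p ≠ 3 := fun h => he (.inr h)
    simp only [he, e2, e3, if_false]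
    rw [max_eq_left, max_eq_left, max_eq_left] <;> linarith

/-- Distinct scaled addresses differ by at least `2 ^ (-n)`, and so do the two values of the scaled
flag. Thus each kind of error alone contributes at least `2 ^ (-n)`. -/
theorem goodAt_of_violation_lt
    (hb : memory u n p (addr u n p) = true ↔ b = true ∧ m = addr u n p)
    (hv : ∑ t, violation u n (if b then 1 / 2 ^ n else 0) (m / 2 ^ n) p t < 1 / 2 ^ n) :
    GoodAt u n p := by
  intro he
  have hd : (0 : ℚ) < 1 / 2 ^ n := by positivity
  have hne : (2 : Fin 4) ≠ 3 := by decide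
  simp only [Fin.sum_univ_three, violation, scaledAddr] at hv
  simp only [Matrix.cons_val, he, if_true] at hv
  set v0 := |(addr u n p : ℚ) / 2 ^ n - nextAddr u n p / 2 ^ n| - 1 + 1 with hv0
  set v1 := (if b = true then (1 : ℚ) / 2 ^ n else 0) - |(addr u n p : ℚ) / 2 ^ n - m / 2 ^ n|
    - 1 / 2 ^ n + if u p = 3 then 1 / 2 ^ n else 0 with hv1
  set v2 := (1 : ℚ) / 2 ^ n - (if b = true then (1 : ℚ) / 2 ^ n else 0)
    + |(addr u n p : ℚ) / 2 ^ n - m / 2 ^ n| - 2 + 2 * if u p = 2 then 1 else 0 with hv2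
  have l0 := le_max_left 0 v0
  have l1 := le_max_left 0 v1
  have l2 := le_max_left 0 v2
  have r0 := le_max_right 0 v0
  have r1 := le_max_right 0 v1
  have r2 := le_max_right 0 v2
  refine ⟨?_, ?_⟩
  · by_contra h
    have := le_scaled_abs_sub (n := n) h
    linarith
  · rcases he with he' | he'
    · simp only [he', hne, false_iff, Bool.not_eq_false]
      rw [he', if_pos rfl] at hv2
      refine hb.2 ⟨?_, ?_⟩
      · by_contra hbf
        rw [if_neg hbf] at hv2
        have := abs_nonneg ((addr u n p : ℚ) / 2 ^ n - m / 2 ^ n)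
        linarith
      · by_contra h
        have := le_scaled_abs_sub (n := n) (Ne.symm h)
        have : (if b = true then (1 : ℚ) / 2 ^ n else 0) ≤ 1 / 2 ^ n := by split <;> linarith
        linarith
    · simp only [he', true_iff]
      by_contra h
      obtain ⟨hbt, hma⟩ := hb.1 (by simpa using h)
      rw [he', if_pos rfl, if_pos hbt, hma, sub_self, abs_zero] at hv1
      linarith

end violation

/-! ### The transformers -/

/-- The transformer accepting the logs of counter runs with addresses of `n` bits that end with a
flip at the highest address. -/
def counterUHAT (n : ℕ) : UHAT 4 where
  dim := 9
  dim_pos := by norm_num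
  emb a := addrVec a 0 0
  outDim := 1
  layers := shiftLayers checkLayers n
  acc := ![1]
  out := .last

/-- With `δ = 2 ^ (-n)`, the output at a final event with scaled address `x` is `x + 3δ/2 - 1` minus
the largest violation. For the highest address, `x = 1 - δ`, this is `δ/2` minus the violation,
hence positive iff there is no violation. A smaller address gives at most `-δ/2`, and a final
non-event loses a further `2`. -/
theorem mem_counterUHAT_language (n : ℕ) (w : List (Fin 4)) :
    w ∈ (counterUHAT n).language ↔ 0 < w.length ∧
      IsEvent (w.getD (w.length - 1) 0) ∧ addr (w.getD · 0) n (w.length - 1) + 1 = 2 ^ n ∧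
      ∀ p < w.length, GoodAt (w.getD · 0) n p := by
  set u : ℕ → Fin 4 := (w.getD · 0) with hu
  have hrun : (counterUHAT n).output w =
      checkLayers.run (fun i : Fin w.length => addrVec (u i) n (addr u n i)) := by
    have h := shiftLayers_run (N := w.length) checkLayers u n 0
    rw [Nat.zero_add] at h
    rw [← h]
    simp only [UHAT.output, counterUHAT, addr, hu]
    simp
  have hiff : w ∈ (counterUHAT n).language ↔ ∃ h : 0 < w.length,
      0 < checkLayers.run (fun i : Fin w.length => addrVec (u i) n (addr u n i))
        ⟨w.length - 1, by omega⟩ 0 := by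
    rw [← hrun]
    have hdot : ∀ x : Fin 1 → ℚ, ![1] ⬝ᵥ x = x 0 := fun x => by simp [dotProduct]
    refine exists_congr fun h => ?_
    exact iff_of_eq (congrArg (0 < ·) (hdot _))
  rw [hiff]
  clear hiff hrun
  by_cases hpos : 0 < w.length
  swap
  · exact iff_of_false (fun h => hpos h.1) (fun h => hpos h.1)
  obtain ⟨b, m, hbm, j, hout, hmax⟩ :=
    checkLayers_run (u := u) (n := n) (⟨w.length - 1, by omega⟩ : Fin w.length)
  have hd : (0 : ℚ) < 1 / 2 ^ n := by positivity
  have hd1 : (1 : ℚ) / 2 ^ n ≤ 1 := by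
    rw [div_le_one (by positivity)]; exact one_le_pow₀ (by norm_num)
  have hv := violation_nonneg (u := u) (n := n) (p := j) (if b j then 1 / 2 ^ n else 0)
    (m j / 2 ^ n)
  have hlt : (addr u n (w.length - 1) : ℚ) + 1 ≤ 2 ^ n := by
    exact_mod_cast addr_lt u n (w.length - 1)
  have hS : scaledAddr u n (w.length - 1) + 1 / 2 ^ n ≤ 1 := by
    rw [scaledAddr, ← add_div, div_le_one (by positivity)]; exact hlt
  rw [exists_prop_of_true hpos, hout]
  simp only [hpos, true_and]
  change _ ↔ IsEvent (u _) ∧ _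
  constructor
  · intro hacc
    have he : IsEvent (u (w.length - 1)) := by
      by_contra he
      rw [if_neg he] at hacc
      linarith
    rw [if_pos he] at hacc
    have ha : addr u n (w.length - 1) + 1 = 2 ^ n := by
      refine le_antisymm (addr_lt u n _) (not_lt.1 fun h => ?_)
      have h' : (addr u n (w.length - 1) : ℚ) + 1 + 1 ≤ 2 ^ n := by exact_mod_cast h
      have : scaledAddr u n (w.length - 1) + 1 / 2 ^ n + 1 / 2 ^ n ≤ 1 := by
        rw [scaledAddr, ← add_div, ← add_div, div_le_one (by positivity)]; exact h'
      linarith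
    refine ⟨he, ha, fun p hp => goodAt_of_violation_lt (hbm ⟨p, hp⟩).2 ?_⟩
    have := hmax ⟨p, hp⟩
    simp only at this
    linarith
  · rintro ⟨he, ha, hg⟩
    have h0 := violation_eq_zero (hbm j).1 (hbm j).2 (hg j j.2)
    have ha' : scaledAddr u n (w.length - 1) + 1 / 2 ^ n = 1 := by
      rw [scaledAddr, ← add_div, div_eq_one_iff_eq (by positivity)]; exact_mod_cast ha
    rw [h0, if_pos he]
    linarith

theorem exists_mem_counterUHAT_language (n : ℕ) : ∃ w, w ∈ (counterUHAT n).language := by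
  obtain ⟨u, N, hg, he, ha⟩ := exists_goodLog n
  let w : List (Fin 4) := List.ofFn fun i : Fin (N + 1) => u i
  have hlen : w.length = N + 1 := List.length_ofFn
  have hw : ∀ p ≤ N, w.getD p 0 = u p := by
    intro p hp
    rw [List.getD_eq_getElem _ _ (by omega)]
    simp only [w, List.getElem_ofFn]
  have haddr : ∀ k, ∀ p ≤ N + 1, addr (w.getD · 0) k p = addr u k p := by
    intro k
    induction k with
    | zero => intros; rfl
    | succ k ih =>
      intro p hp
      cases p with
      | zero => rfl
      | succ p => rw [addr, addr, ih p (by omega), hw p (by omega)]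
  have hstate : ∀ p ≤ N + 1, nextAddr (w.getD · 0) n p = nextAddr u n p ∧
      memory (w.getD · 0) n p = memory u n p := by
    intro p
    induction p with
    | zero => intros; exact ⟨rfl, rfl⟩
    | succ p ih =>
      intro hp
      obtain ⟨h1, h2⟩ := ih (by omega)
      simp only [nextAddr, memory, h1, h2, hw p (by omega), haddr n p (by omega), and_self]
  refine ⟨w, (mem_counterUHAT_language n w).2 ⟨by omega, ?_, ?_, fun p hp => ?_⟩⟩
  · rw [hlen, Nat.add_sub_cancel, hw N le_rfl]; exact he
  · rw [hlen, Nat.add_sub_cancel, haddr n N (by omega)]; exact ha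
  · obtain ⟨h1, h2⟩ := hstate p (by omega)
    have := hg p (by omega)
    simpa only [GoodAt, h1, h2, hw p (by omega), haddr n p (by omega)] using this

/-- At the final event the expected address equals the one read, `2 ^ n - 1`; insert this into
`bitValue_memory_le`. -/
theorem le_length_of_mem_counterUHAT_language {n : ℕ} {w : List (Fin 4)}
    (hw : w ∈ (counterUHAT n).language) : 2 ^ (2 ^ n - 1) ≤ w.length := by
  obtain ⟨h0, he, ha, hg⟩ := (mem_counterUHAT_language n w).1 hw
  have h := bitValue_memory_le (w.getD · 0) n (w.length - 1) fun q hq => hg q (by omega)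
  rw [← (hg (w.length - 1) (by omega) he).1] at h
  rw [show 2 ^ n - 1 = addr (w.getD · 0) n (w.length - 1) by omega]
  omega

/-! ### Sizes and the succinctness gap -/

/-- Every round is encoded by the same bit string, as its coefficients do not depend on the round.
Positivity of `c` makes the sizes unbounded, as needed for asymptotic arguments. -/
theorem exists_shiftLayers_encode_length {e : ℕ} (L : Layers 9 e) : ∃ c : ℕ, 0 < c ∧
    ∀ n, (shiftLayers L n).encode.length = L.encode.length + c * n := by
  obtain ⟨X, hX, h⟩ : ∃ X : List Bool, X ≠ [] ∧ ∀ n,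
      (shiftLayers L (n + 1)).encode = X ++ (shiftLayers L n).encode := by
    refine ⟨[false, true] ++ encNat 9 ++ (zeroAffine 9 9).encode ++ (zeroAffine 9 9).encode ++
      shiftAffine.encode ++ Mask.future.encode ++ TieBreak.rightmost.encode ++
      ([true, false] ++ encNat (7 : Fin 9) ++ ([true, false] ++ encNat (8 : Fin 9))),
      List.cons_ne_nil _ _, fun n => ?_⟩
    simp only [shiftLayers, Layers.encode, List.append_assoc]
  refine ⟨X.length, List.length_pos_iff.2 hX, fun n => ?_⟩
  induction n with
  | zero => rfl
  | succ n ih => rw [h, List.length_append, ih]; ring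

theorem exists_counterUHAT_size : ∃ a b : ℕ, 0 < b ∧ ∀ n, (counterUHAT n).size = a + b * n := by
  obtain ⟨c, hc, h⟩ := exists_shiftLayers_encode_length checkLayers
  refine ⟨(counterUHAT 0).size, c, hc, fun n => ?_⟩
  simp only [UHAT.size, UHAT.encode, List.length_append]
  have h1 := h n
  have h2 := h 0
  simp only [counterUHAT] at *
  omega

theorem two_pow_two_pow_le_length {n : ℕ} {w : List (Fin 4)}
    (hw : w ∈ (counterUHAT (n + 1)).language) : 2 ^ 2 ^ n ≤ w.length := by
  refine le_trans (Nat.pow_le_pow_right (by norm_num) ?_)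
    (le_length_of_mem_counterUHAT_language hw)
  have : 0 < 2 ^ n := by positivity
  rw [pow_succ]; omega

theorem uhat_canBeExpMoreSuccinct_ltl : CanBeExpMoreSuccinct uhatClass ltlClass := by
  rintro f ⟨g, hg, hf⟩
  obtain ⟨a, b, hb, hsize⟩ := exists_counterUHAT_size
  -- For `n ≥ 1` the size `a + b * (n + 1)` is at most `(a + b + b) * n`, so this constant bounds
  -- the exponent `g` at the size by `n / 2 < n`.
  have hc : (0 : ℝ) < 1 / (2 * (a + b + b : ℝ)) := by positivity
  have hev := (hg.bound hc).and hf
  obtain ⟨M, hM⟩ := eventually_atTop.1 hev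
  set n := max M 1 with hn
  have hMn : M ≤ a + b * (n + 1) := by
    have : M ≤ n := le_max_left _ _
    nlinarith
  have hn1 : 1 ≤ n := le_max_right _ _
  obtain ⟨h1, h2⟩ := hM _ hMn
  refine ⟨4, counterUHAT (n + 1), fun R hR => ?_⟩
  change f (counterUHAT (n + 1)).size < ((LTLRecognizer.size R : ℕ) : ℝ)
  change LTLRecognizer.language R = (counterUHAT (n + 1)).language at hR
  obtain ⟨w, hw, hlen⟩ := R.exists_short_word (hR ▸ exists_mem_counterUHAT_language (n + 1))
  have h3 : 2 ^ n ≤ R.size :=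
    (Nat.pow_le_pow_iff_right (by norm_num)).1
      ((two_pow_two_pow_le_length (hR ▸ hw)).trans hlen)
  rw [hsize]
  refine lt_of_le_of_lt h2 (lt_of_lt_of_le ?_ (by exact_mod_cast h3 : (2 : ℝ) ^ n ≤ R.size))
  rw [← Real.rpow_natCast]
  refine Real.rpow_lt_rpow_of_exponent_lt (by norm_num) ?_
  have hn1' : (1 : ℝ) ≤ n := by exact_mod_cast hn1
  refine lt_of_le_of_lt (le_abs_self _ |>.trans h1) ?_
  rw [Real.norm_of_nonneg (Nat.cast_nonneg _), div_mul_eq_mul_div, one_mul,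
    div_lt_iff₀ (by positivity)]
  push_cast
  have ha : (0 : ℝ) ≤ a := Nat.cast_nonneg _
  have hb' : (0 : ℝ) < b := by exact_mod_cast hb
  nlinarith

theorem mainTheorem3 :
    CanBeExpMoreSuccinct uhatClass ltlClass ∧
    (∃ (p : Polynomial ℕ) (k : ℕ → ℕ) (T : (n : ℕ) → UHAT (k n)), ∀ n : ℕ,
      (T n).size ≤ p.eval n ∧
      (∃ w, w ∈ (T n).language) ∧
      ∀ w ∈ (T n).language, 2 ^ 2 ^ n ≤ w.length) ∧
    (∃ c : ℕ, ∀ (k : ℕ) (R : LTLRecognizer k), (∃ w, w ∈ R.language) →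
      ∃ w ∈ R.language, w.length ≤ 2 ^ (c * R.size)) := by
  refine ⟨uhat_canBeExpMoreSuccinct_ltl, ?_, 1, fun k R h => ?_⟩
  · obtain ⟨a, b, -, hsize⟩ := exists_counterUHAT_size
    refine ⟨.C a + .C b * (.X + 1), fun _ => 4, fun n => counterUHAT (n + 1), fun n =>
      ⟨?_, exists_mem_counterUHAT_language _, fun w hw => two_pow_two_pow_le_length hw⟩⟩
    simp [hsize]
  · simpa using R.exists_short_word h
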